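/- Let $n \ge d \ge 1$ be integers and $\sigma, R, B > 0$. Let $\mathcal X_{n,d}(B)$ be the set of matrices $X \in \mathbb R^{n\times d}$ with $\frac1n X^{\mathsf T}X \succeq \frac1B I_d$. For $\theta\in\mathbb R^d$ let $\|\theta\|_p = (\sum_{i=1}^d |\theta_i|^p)^{1/p}$ if $p\in(0,1]$, and let $\|\theta\|_0$ be the number of nonzero entries of $\theta$. Define the minimax risk $$\mathfrak M_{n,d}(p,\sigma,R,B) = \inf_{\hat\theta}\ \sup_{X\in\mathcal X_{n,d}(B)}\ \sup_{\|\theta^\star\|_p\le R}\ \mathbf E_{y\sim \mathsf N(X\theta^\star,\sigma^2 I_n)}\big[\|\hat\theta(X,y)-\theta^\star\|_2^2\big],$$ where the infimum is over all maps $\hat\theta(X,y)\in\mathbb R^d$ that are, for each fixed $X$, measurable functions of $y\in\mathbb R^n$. Put $\tau_n = \big(\sigma^2B/(R^2n)\big)^{1/2}$. There exist universal constants $0<c_\ell<c_u<\infty$ (not depending on $n,d,p,\sigma,R,s,B$) such that the following hold. (a) If $p\in(0,1]$ and $\tau_n^2\in[d^{-2/p},\,1/\log(ed)]$, then $$c_\ell\,R^2\big(\tau_n^2\log(e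 d\,\tau_n^p)\big)^{1-p/2}\ \le\ \mathfrak M_{n,d}(p,\sigma,R,B)\ \le\ c_u\,R^2\big(\tau_n^2\log(e d\,\tau_n^p)\big)^{1-p/2}.$$ (b) If $p=0$ and $R=s$ is an integer with $1\le s\le d$, then $$c_\ell\,\frac{\sigma^2B}{n}\,s\log\Big(\frac{ed}{s}\Big)\ \le\ \mathfrak M_{n,d}(0,\sigma,s,B)\ \le\ c_u\,\frac{\sigma^2B}{n}\,s\log\Big(\frac{ed}{s}\Big).$$ -/

import Mathlib

open scoped ENNReal

noncomputable section

namespace SparseRegression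

/-- The designs `X ∈ ℝ^{n × d}` with `(1/n) Xᵀ X ⪰ (1/B) I_d` in the Loewner order. -/
def designClass (n d : ℕ) (B : ℝ) : Set (Matrix (Fin n) (Fin d) ℝ) :=
  {X | ((1 / (n : ℝ)) • (X.transpose * X) - (1 / B) • (1 : Matrix (Fin d) (Fin d) ℝ)).PosSemidef}

/-- The ball `{θ ∈ ℝ^d : ‖θ‖_p ≤ R}` for `p ≥ 0`. Mathlib's `ℓ_p` (quasi)norm is
`(∑ i, |θ i| ^ p) ^ (1 / p)` for real `p > 0`, and the number of nonzero entries for `p = 0`;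
see `mem_lpBall_iff` and `mem_lpBall_zero_iff`. -/
def lpBall (d : ℕ) (p R : ℝ) : Set (EuclideanSpace ℝ (Fin d)) :=
  {θ | ‖WithLp.toLp (ENNReal.ofReal p) (WithLp.ofLp θ)‖ ≤ R}

/-- The law `N(X θ, σ² I_n)` of the observation `y` in the linear model. -/
def obsLaw {n d : ℕ} (σ : ℝ) (X : Matrix (Fin n) (Fin d) ℝ) (θ : EuclideanSpace ℝ (Fin d)) :
    MeasureTheory.Measure (EuclideanSpace ℝ (Fin n)) :=
  ProbabilityTheory.multivariateGaussian (Matrix.toEuclideanLin X θ)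
    ((σ ^ 2) • (1 : Matrix (Fin n) (Fin n) ℝ))

/-- The mean squared `ℓ₂` error of the estimator `θhat` under the design `X` and the parameter `θ`,
as an extended nonnegative real (it may be infinite). -/
def risk {n d : ℕ} (σ : ℝ)
    (θhat : Matrix (Fin n) (Fin d) ℝ → EuclideanSpace ℝ (Fin n) → EuclideanSpace ℝ (Fin d))
    (X : Matrix (Fin n) (Fin d) ℝ) (θ : EuclideanSpace ℝ (Fin d)) : ℝ≥0∞ :=
  ∫⁻ y, ENNReal.ofReal (‖θhat X y - θ‖ ^ 2) ∂(obsLaw σ X θ)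

/-- The minimax risk over designs in `designClass n d B` and parameters in `lpBall d p R`.
The design is known to the statistician: an estimator is a map `θhat(X, y)` that is, for each
design, a measurable function of the observation vector `y`. -/
def minimaxRisk (n d : ℕ) (p σ R B : ℝ) : ℝ≥0∞ :=
  ⨅ (θhat : Matrix (Fin n) (Fin d) ℝ → EuclideanSpace ℝ (Fin n) → EuclideanSpace ℝ (Fin d))
    (_ : ∀ X, Measurable (θhat X)),
    ⨆ X ∈ designClass n d B, ⨆ θ ∈ lpBall d p R, risk σ θhat X θ

/-- The inverse signal-to-noise ratio `τ_n`, with `τ_n² = σ² B / (R² n)`. -/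
def tau (n : ℕ) (σ R B : ℝ) : ℝ :=
  Real.sqrt (σ ^ 2 * B / (R ^ 2 * n))

/-- The rate `R² (τ_n² log (e d τ_n^p))^{1 - p/2}`. -/
def weakRate (n d : ℕ) (p σ R B : ℝ) : ℝ :=
  R ^ 2 * (tau n σ R B ^ 2 * Real.log (Real.exp 1 * d * tau n σ R B ^ p)) ^ (1 - p / 2)

/-- The rate `(σ² B / n) s log (e d / s)`. -/
def hardRate (n d s : ℕ) (σ B : ℝ) : ℝ :=
  σ ^ 2 * B / n * s * Real.log (Real.exp 1 * (d / s))

theorem mem_lpBall_iff {d : ℕ} {p R : ℝ} (hp : 0 < p) (θ : EuclideanSpace ℝ (Fin d)) :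
    θ ∈ lpBall d p R ↔ (∑ i, |θ i| ^ p) ^ (1 / p) ≤ R := by
  have h : (ENNReal.ofReal p).toReal = p := ENNReal.toReal_ofReal hp.le
  unfold lpBall
  rw [Set.mem_ofPred_eq, PiLp.norm_eq_sum (by rw [h]; exact hp), h]
  simp only [Real.norm_eq_abs]

theorem mem_lpBall_zero_iff {d : ℕ} {R : ℝ} (θ : EuclideanSpace ℝ (Fin d)) :
    θ ∈ lpBall d 0 R ↔ ((Finset.univ.filter fun i => θ i ≠ 0).card : ℝ) ≤ R := by
  unfold lpBall
  rw [Set.mem_ofPred_eq, ENNReal.ofReal_zero, PiLp.norm_eq_card]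
  have h : ({i | ‖(WithLp.toLp 0 (WithLp.ofLp θ) : PiLp 0 fun _ : Fin d => ℝ) i‖ ≠ 0} :
      Set (Fin d)).toFinite.toFinset = Finset.univ.filter fun i => θ i ≠ 0 := by
    ext i
    simp
  rw [h]

theorem tau_sq {n : ℕ} {σ R B : ℝ} (hB : 0 < B) :
    tau n σ R B ^ 2 = σ ^ 2 * B / (R ^ 2 * n) :=
  Real.sq_sqrt (by positivity)

end SparseRegression

end

/-!
The upper bound is achieved by soft thresholding the least squares estimator coordinate by
coordinate. For `X` in the design class, the `i`-th least squares coordinate is a Gaussian variable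
with mean `θ i` and variance at most `v = σ² B / n` (`exists_dual_vector`). Soft thresholding at the
level `√(2 v l)` has coordinate risk at most `8 min (θ i ^ 2) (2 v l) + 4 v exp (-l)`
(`lintegral_softThreshold_le`). The errors are added up over the coordinates, so their correlation
is irrelevant (`minimaxRisk_le`). With `l = log (e d / s)`, respectively `l = log (e d τ^p)`, both
terms sum to a multiple of the rate, in the second case because
`min (θ ^ 2) y ≤ |θ| ^ p * y ^ (1 - p / 2)`.

For the lower bound, the design is a multiple of the first `d` columns of the identity, and the
prior splits `k * m` of the coordinates into `k` blocks of size `m`, each containing, independently,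
no spike or one spike `a` at a uniform position, with probability one half each. Within one block,
the average likelihood ratio of "spike" against "no spike" has second moment
`1 + (exp (a² / v) - 1) / m ≤ 2` as soon as `a² ≤ v log (1 + m)`, so that no estimator can tell the
two apart (`spike_risk_ge`); the likelihood ratios come from the Cameron–Martin formula
`withDensity_shiftDensity`. Summing over the blocks gives the minimax lower bound `k a² / 6`
(`minimaxRisk_ge`). Allowing the absence of a spike makes the bound valid for `m = 1` too, so the
dense regime `s ≈ d` needs no separate prior. The rates follow with `k = s`, respectively with the
largest `k` for which `k` spikes of size `R √(τ² log (e d τ^p))` fit into the ball.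
-/

noncomputable section

namespace SparseRegression

open MeasureTheory ProbabilityTheory
open scoped RealInnerProductSpace

/-! ### Isotropic Gaussian measures and their shifts -/

section Gaussian

variable {n : ℕ} {σ : ℝ} {m : EuclideanSpace ℝ (Fin n)}

theorem posSemidef_sq_smul_one (n : ℕ) (σ : ℝ) :
    ((σ ^ 2) • (1 : Matrix (Fin n) (Fin n) ℝ)).PosSemidef :=
  Matrix.PosSemidef.one.smul (sq_nonneg σ)

theorem map_inner_isotropicGaussian (u : EuclideanSpace ℝ (Fin n)) :
    (multivariateGaussian m ((σ ^ 2) • (1 : Matrix (Fin n) (Fin n) ℝ))).map (fun y => ⟪u, y⟫) =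
      gaussianReal ⟪u, m⟫ (σ ^ 2 * ‖u‖ ^ 2).toNNReal := by
  set P := multivariateGaussian m ((σ ^ 2) • (1 : Matrix (Fin n) (Fin n) ℝ)) with hP
  have h := IsGaussian.map_eq_gaussianReal (μ := P) (innerSL ℝ u)
  have hmean : P[innerSL ℝ u] = ⟪u, m⟫ := by
    rw [(innerSL ℝ u).integral_comp_id_comm IsGaussian.integrable_id]
    simp [hP]
  have hvar : Var[innerSL ℝ u; P] = σ ^ 2 * ‖u‖ ^ 2 := by
    rw [← covariance_self (by fun_prop)]
    have h2 : cov[fun y => ⟪u, y⟫, fun y => ⟪u, y⟫; P] = σ ^ 2 * ‖u‖ ^ 2 := by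
      rw [← covarianceBilin_apply_eq_cov IsGaussian.memLp_two_id, hP,
        covarianceBilin_multivariateGaussian (posSemidef_sq_smul_one n σ), Matrix.smul_mulVec,
        Matrix.one_mulVec, EuclideanSpace.real_norm_sq_eq, dotProduct, Finset.mul_sum]
      exact Finset.sum_congr rfl fun i _ => by simp; ring
    exact h2
  rw [hmean, hvar] at h
  exact h

theorem integrable_exp_inner (u : EuclideanSpace ℝ (Fin n)) :
    Integrable (fun y => Real.exp ⟪u, y⟫)
      (multivariateGaussian m ((σ ^ 2) • (1 : Matrix (Fin n) (Fin n) ℝ))) := by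
  have h := integrable_exp_mul_gaussianReal (μ := ⟪u, m⟫) (v := (σ ^ 2 * ‖u‖ ^ 2).toNNReal) 1
  rw [← map_inner_isotropicGaussian, integrable_map_measure (by fun_prop) (by fun_prop)] at h
  simpa [Function.comp_def] using h

/-- The moment generating function of `N(m, σ² I)`. -/
theorem integral_exp_inner (u : EuclideanSpace ℝ (Fin n)) :
    ∫ y, Real.exp ⟪u, y⟫ ∂(multivariateGaussian m ((σ ^ 2) • (1 : Matrix (Fin n) (Fin n) ℝ))) =
      Real.exp (⟪u, m⟫ + σ ^ 2 * ‖u‖ ^ 2 / 2) := by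
  have h := mgf_gaussianReal (map_inner_isotropicGaussian (σ := σ) (m := m) u) 1
  rw [Real.coe_toNNReal _ (by positivity)] at h
  simpa [mgf] using h

/-- The density of `N(m + h, σ² I)` with respect to `N(m, σ² I)`. -/
def shiftDensity (σ : ℝ) (m h y : EuclideanSpace ℝ (Fin n)) : ℝ :=
  Real.exp (⟪(σ ^ 2)⁻¹ • h, y⟫ - (⟪h, m⟫ + ‖h‖ ^ 2 / 2) / σ ^ 2)

theorem shiftDensity_nonneg (m h y : EuclideanSpace ℝ (Fin n)) : 0 ≤ shiftDensity σ m h y :=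
  (Real.exp_pos _).le

theorem measurable_shiftDensity (m h : EuclideanSpace ℝ (Fin n)) :
    Measurable (shiftDensity σ m h) := by
  unfold shiftDensity
  fun_prop

theorem integrable_shiftDensity (m' h : EuclideanSpace ℝ (Fin n)) :
    Integrable (shiftDensity σ m' h)
      (multivariateGaussian m ((σ ^ 2) • (1 : Matrix (Fin n) (Fin n) ℝ))) := by
  unfold shiftDensity
  simp_rw [Real.exp_sub]
  exact (integrable_exp_inner _).div_const _

theorem integral_shiftDensity (hσ : 0 < σ) (m h : EuclideanSpace ℝ (Fin n)) :
    ∫ y, shiftDensity σ m h y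
      ∂(multivariateGaussian m ((σ ^ 2) • (1 : Matrix (Fin n) (Fin n) ℝ))) = 1 := by
  unfold shiftDensity
  simp_rw [Real.exp_sub]
  rw [integral_div, integral_exp_inner, ← Real.exp_sub, real_inner_smul_left, norm_smul,
    Real.norm_of_nonneg (by positivity)]
  convert Real.exp_zero
  field_simp
  ring

theorem shiftDensity_mul_eq (hσ : 0 < σ) (m h h' y : EuclideanSpace ℝ (Fin n)) :
    shiftDensity σ m h y * shiftDensity σ m h' y =
      Real.exp (⟪h, h'⟫ / σ ^ 2) * shiftDensity σ m (h + h') y := by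
  unfold shiftDensity
  rw [← Real.exp_add, ← Real.exp_add, norm_add_sq_real]
  congr 1
  simp only [real_inner_smul_left, inner_add_left]
  field_simp
  ring

theorem integrable_shiftDensity_mul (hσ : 0 < σ) (m' h h' : EuclideanSpace ℝ (Fin n)) :
    Integrable (fun y => shiftDensity σ m' h y * shiftDensity σ m' h' y)
      (multivariateGaussian m ((σ ^ 2) • (1 : Matrix (Fin n) (Fin n) ℝ))) := by
  simp_rw [shiftDensity_mul_eq hσ]
  exact (integrable_shiftDensity _ _).const_mul _

theorem integral_shiftDensity_mul (hσ : 0 < σ) (m h h' : EuclideanSpace ℝ (Fin n)) :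
    ∫ y, shiftDensity σ m h y * shiftDensity σ m h' y
      ∂(multivariateGaussian m ((σ ^ 2) • (1 : Matrix (Fin n) (Fin n) ℝ))) =
      Real.exp (⟪h, h'⟫ / σ ^ 2) := by
  simp_rw [shiftDensity_mul_eq hσ]
  rw [integral_const_mul, integral_shiftDensity hσ, mul_one]

/-- The Cameron–Martin formula for `N(m, σ² I)`. Both sides have the same moment generating
function along every direction, and it is finite everywhere, so that it determines the
characteristic function. -/
theorem withDensity_shiftDensity (hσ : 0 < σ) (m h : EuclideanSpace ℝ (Fin n)) :
    (multivariateGaussian m ((σ ^ 2) • (1 : Matrix (Fin n) (Fin n) ℝ))).withDensity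
        (fun y => ENNReal.ofReal (shiftDensity σ m h y)) =
      multivariateGaussian (m + h) ((σ ^ 2) • (1 : Matrix (Fin n) (Fin n) ℝ)) := by
  set P := multivariateGaussian m ((σ ^ 2) • (1 : Matrix (Fin n) (Fin n) ℝ)) with hP
  set P' := multivariateGaussian (m + h) ((σ ^ 2) • (1 : Matrix (Fin n) (Fin n) ℝ)) with hP'
  set Q := P.withDensity (fun y => ENNReal.ofReal (shiftDensity σ m h y)) with hQ
  have hmeas : Measurable (fun y => ENNReal.ofReal (shiftDensity σ m h y)) :=
    (measurable_shiftDensity m h).ennreal_ofReal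
  have hQprob : IsProbabilityMeasure Q := by
    constructor
    rw [hQ, withDensity_apply _ MeasurableSet.univ, Measure.restrict_univ,
      ← ofReal_integral_eq_lintegral_ofReal (integrable_shiftDensity m h)
        (.of_forall fun y => shiftDensity_nonneg m h y), integral_shiftDensity hσ,
      ENNReal.ofReal_one]
  have hexp (u : EuclideanSpace ℝ (Fin n)) :
      ∫ y, Real.exp ⟪u, y⟫ ∂Q = ∫ y, Real.exp ⟪u, y⟫ ∂P' := by
    rw [hQ, integral_withDensity_eq_integral_toReal_smul hmeas (by simp), hP',
      integral_exp_inner]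
    have hfun : ∀ y, (ENNReal.ofReal (shiftDensity σ m h y)).toReal • Real.exp ⟪u, y⟫ =
        Real.exp ⟪(σ ^ 2)⁻¹ • h + u, y⟫ * Real.exp (-((⟪h, m⟫ + ‖h‖ ^ 2 / 2) / σ ^ 2)) := by
      intro y
      rw [ENNReal.toReal_ofReal (shiftDensity_nonneg m h y), smul_eq_mul, shiftDensity,
        ← Real.exp_add, ← Real.exp_add, inner_add_left]
      congr 1
      ring
    simp_rw [hfun]
    rw [integral_mul_const, hP, integral_exp_inner, ← Real.exp_add, norm_add_sq_real, norm_smul,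
      Real.norm_of_nonneg (by positivity), inner_add_left, inner_add_right, real_inner_smul_left,
      real_inner_smul_left, real_inner_comm h u]
    congr 1
    field_simp
    ring
  have hinner (s : ℝ) (t y : EuclideanSpace ℝ (Fin n)) : s * ⟪y, t⟫ = ⟪s • t, y⟫ := by
    rw [real_inner_smul_left, real_inner_comm]
  have hmgf (t : EuclideanSpace ℝ (Fin n)) :
      mgf (fun y => ⟪y, t⟫) Q = mgf (fun y => ⟪y, t⟫) P' := by
    ext s
    simpa only [mgf, hinner] using hexp (s • t)
  refine Measure.ext_of_charFun (funext fun t => ?_)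
  have hset : integrableExpSet (fun y => ⟪y, t⟫) P' = Set.univ := by
    ext s
    have := integrable_exp_inner (σ := σ) (m := m + h) (s • t)
    simpa only [integrableExpSet, Set.mem_ofPred_eq, Set.mem_univ, iff_true, hinner] using this
  have h1 := eqOn_complexMGF_of_mgf (hmgf t).symm (x := Complex.I) (by rw [hset]; simp)
  rw [charFun_apply, charFun_apply]
  simpa only [complexMGF, mul_comm Complex.I] using h1.symm

end Gaussian

/-! ### Least squares on the design class -/

section Design

theorem mul_sq_norm_le_of_mem_designClass {n d : ℕ} {B : ℝ} (hn : 0 < n)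
    {X : Matrix (Fin n) (Fin d) ℝ} (hX : X ∈ designClass n d B) (θ : EuclideanSpace ℝ (Fin d)) :
    n / B * ‖θ‖ ^ 2 ≤ ‖Matrix.toEuclideanLin X θ‖ ^ 2 := by
  have hX' : ((1 / (n : ℝ)) • (X.transpose * X) -
      (1 / B) • (1 : Matrix (Fin d) (Fin d) ℝ)).PosSemidef := hX
  have h := hX'.dotProduct_mulVec_nonneg (WithLp.ofLp θ)
  have h1 : ‖Matrix.toEuclideanLin X θ‖ ^ 2 =
      (X.mulVec (WithLp.ofLp θ)) ⬝ᵥ (X.mulVec (WithLp.ofLp θ)) := by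
    rw [EuclideanSpace.real_norm_sq_eq, dotProduct]
    exact Finset.sum_congr rfl fun i _ => by simp [sq]
  have h2 : ‖θ‖ ^ 2 = (WithLp.ofLp θ) ⬝ᵥ (WithLp.ofLp θ) := by
    rw [EuclideanSpace.real_norm_sq_eq, dotProduct]
    exact Finset.sum_congr rfl fun i _ => by simp [sq]
  have hn' : (0 : ℝ) < n := by exact_mod_cast hn
  simp only [star_trivial, Matrix.sub_mulVec, Matrix.smul_mulVec, Matrix.one_mulVec,
    dotProduct_sub, dotProduct_smul, smul_eq_mul, ← Matrix.mulVec_mulVec] at h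
  rw [Matrix.dotProduct_mulVec, Matrix.vecMul_transpose, ← h1, ← h2] at h
  have h3 := mul_nonneg hn'.le h
  field_simp at h3 ⊢
  linarith

/-- A dual vector of a linear map that expands norms: `⟪u, ·⟫` is the `i`-th coordinate of the least
squares estimator. Since `u` is taken in the range of `f`, say `u = f g`, one has
`c * ‖u‖ ^ 4 = c * (g i) ^ 2 ≤ ‖f g‖ ^ 2 = ‖u‖ ^ 2`. -/
theorem exists_dual_vector {n d : ℕ} {c : ℝ} (hc : 0 < c)
    (f : EuclideanSpace ℝ (Fin d) →ₗ[ℝ] EuclideanSpace ℝ (Fin n))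
    (hf : ∀ θ, c * ‖θ‖ ^ 2 ≤ ‖f θ‖ ^ 2) (i : Fin d) :
    ∃ u, (∀ θ, ⟪u, f θ⟫ = θ i) ∧ ‖u‖ ^ 2 ≤ c⁻¹ := by
  have hinj : Function.Injective (f.adjoint ∘ₗ f) := by
    rw [injective_iff_map_eq_zero]
    intro θ hθ
    have h1 : ‖f θ‖ ^ 2 = 0 := by
      rw [← real_inner_self_eq_norm_sq, ← LinearMap.adjoint_inner_left]
      rw [LinearMap.comp_apply] at hθ
      rw [hθ, inner_zero_left]
    have h2 := hf θ
    rw [h1] at h2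
    have h3 : ‖θ‖ ^ 2 ≤ 0 := nonpos_of_mul_nonpos_right h2 hc
    exact norm_eq_zero.1 (pow_eq_zero_iff two_ne_zero |>.1 (le_antisymm h3 (sq_nonneg _)))
  obtain ⟨g, hg⟩ := LinearMap.injective_iff_surjective.1 hinj (EuclideanSpace.single i 1)
  have hdual (θ : EuclideanSpace ℝ (Fin d)) : ⟪f g, f θ⟫ = θ i := by
    rw [← LinearMap.adjoint_inner_left, ← LinearMap.comp_apply, hg]
    simp [EuclideanSpace.inner_single_left]
  refine ⟨f g, hdual, ?_⟩
  have h1 : ‖f g‖ ^ 2 = g i := by rw [← real_inner_self_eq_norm_sq, hdual]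
  have h2 : (g i) ^ 2 ≤ ‖g‖ ^ 2 := by
    rw [EuclideanSpace.real_norm_sq_eq]
    exact Finset.single_le_sum (f := fun j => g j ^ 2) (fun j _ => sq_nonneg _) (Finset.mem_univ i)
  have h3 : c * (g i) ^ 2 ≤ g i :=
    (mul_le_mul_of_nonneg_left h2 hc.le).trans ((hf g).trans_eq h1)
  rw [h1]
  have h0 : 0 ≤ g i := h1 ▸ sq_nonneg _
  rw [← one_div, le_div_iff₀ hc]
  by_contra! hlt
  nlinarith

end Design

/-! ### Soft thresholding -/

section SoftThreshold

/-- Soft thresholding at level `l`: the point `x` minus its projection to `[-l, l]`. -/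
def softThreshold (l x : ℝ) : ℝ := x - max (-l) (min x l)

theorem measurable_softThreshold (l : ℝ) : Measurable (softThreshold l) := by
  unfold softThreshold
  fun_prop

/-- The error is at most the signal, truncated at the threshold, plus the overshoot of the noise. -/
theorem abs_softThreshold_sub_le {l : ℝ} (hl : 0 ≤ l) (t x : ℝ) :
    |softThreshold l x - t| ≤ 2 * min |t| l + max (|x - t| - l) 0 := by
  unfold softThreshold
  rcases max_cases (-l) (min x l) with ⟨h1, h1'⟩ | ⟨h1, h1'⟩ <;>
  rcases min_cases x l with ⟨h2, h2'⟩ | ⟨h2, h2'⟩ <;>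
  rcases min_cases |t| l with ⟨h3, h3'⟩ | ⟨h3, h3'⟩ <;>
  rcases max_cases (|x - t| - l) 0 with ⟨h4, h4'⟩ | ⟨h4, h4'⟩ <;>
  rw [h1, h3, h4] <;> (try rw [h2]) <;>
  rcases abs_cases t with ⟨h5, h5'⟩ | ⟨h5, h5'⟩ <;>
  rcases abs_cases (x - t) with ⟨h6, h6'⟩ | ⟨h6, h6'⟩ <;>
  rw [abs_le] <;> constructor <;> linarith

theorem softThreshold_sub_sq_le {l s : ℝ} (hl : 0 ≤ l) (hs : 0 < s) (t x : ℝ) :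
    (softThreshold l x - t) ^ 2 ≤ 8 * min (t ^ 2) (l ^ 2) +
      4 / s ^ 2 * Real.exp (-(s * l)) * (Real.exp (s * (x - t)) + Real.exp (-(s * (x - t)))) := by
  have h1 : (softThreshold l x - t) ^ 2 ≤ (2 * min |t| l + max (|x - t| - l) 0) ^ 2 := by
    rw [← sq_abs]
    exact pow_le_pow_left₀ (abs_nonneg _) (abs_softThreshold_sub_le hl t x) 2
  have h2 : (min |t| l) ^ 2 ≤ min (t ^ 2) (l ^ 2) := by
    have h0 : 0 ≤ min |t| l := le_min (abs_nonneg _) hl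
    refine le_min ?_ (pow_le_pow_left₀ h0 (min_le_right _ _) 2)
    rw [← sq_abs t]
    exact pow_le_pow_left₀ h0 (min_le_left _ _) 2
  have h3 : (max (|x - t| - l) 0) ^ 2 ≤
      2 / s ^ 2 * Real.exp (s * (|x - t| - l)) := by
    rcases max_cases (|x - t| - l) 0 with ⟨h, h'⟩ | ⟨h, -⟩
    · have := Real.quadratic_le_exp_of_nonneg (mul_nonneg hs.le h')
      rw [h, div_mul_eq_mul_div, le_div_iff₀ (by positivity)]
      nlinarith [mul_nonneg hs.le h']
    · rw [h, zero_pow two_ne_zero]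
      positivity
  have h4 : Real.exp (s * (|x - t| - l)) ≤
      Real.exp (-(s * l)) * (Real.exp (s * (x - t)) + Real.exp (-(s * (x - t)))) := by
    rw [mul_sub, sub_eq_add_neg, Real.exp_add, mul_comm]
    refine mul_le_mul_of_nonneg_left ?_ (Real.exp_pos _).le
    rcases abs_cases (x - t) with ⟨h, -⟩ | ⟨h, -⟩ <;> rw [h]
    · linarith [Real.exp_pos (-(s * (x - t)))]
    · rw [mul_neg]
      linarith [Real.exp_pos (s * (x - t))]
  have h5 : 2 / s ^ 2 * Real.exp (s * (|x - t| - l)) ≤ 2 / s ^ 2 *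
      (Real.exp (-(s * l)) * (Real.exp (s * (x - t)) + Real.exp (-(s * (x - t))))) :=
    mul_le_mul_of_nonneg_left h4 (by positivity)
  calc _ ≤ _ := h1
    _ ≤ 8 * (min |t| l) ^ 2 + 2 * (max (|x - t| - l) 0) ^ 2 := by
      nlinarith [sq_nonneg (2 * min |t| l - max (|x - t| - l) 0)]
    _ ≤ 8 * min (t ^ 2) (l ^ 2) + 2 * (2 / s ^ 2 *
      (Real.exp (-(s * l)) * (Real.exp (s * (x - t)) + Real.exp (-(s * (x - t)))))) := by
      gcongr
      exact h3.trans h5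
    _ = _ := by ring

end SoftThreshold

/-! ### The risk of the thresholded least squares estimator -/

section UpperBound

variable {n d : ℕ} {σ : ℝ}

/-- The risk of soft thresholding a single least squares coordinate with variance at most `v`.
The tail of the noise beyond the threshold is bounded with the exponential moment at the
optimal slope `√(2 v l) / v`. -/
theorem lintegral_softThreshold_le {v l t : ℝ} {m u : EuclideanSpace ℝ (Fin n)} (hv : 0 < v)
    (hl : 1 ≤ l) (hu : σ ^ 2 * ‖u‖ ^ 2 ≤ v) (hm : ⟪u, m⟫ = t) :
    ∫⁻ y, ENNReal.ofReal ((softThreshold (√(2 * v * l)) ⟪u, y⟫ - t) ^ 2)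
      ∂(multivariateGaussian m ((σ ^ 2) • (1 : Matrix (Fin n) (Fin n) ℝ))) ≤
      ENNReal.ofReal (8 * min (t ^ 2) (2 * v * l) + 4 * v * Real.exp (-l)) := by
  set P := multivariateGaussian m ((σ ^ 2) • (1 : Matrix (Fin n) (Fin n) ℝ)) with hP
  set r := √(2 * v * l) with hr
  have hr2 : r ^ 2 = 2 * v * l := Real.sq_sqrt (by positivity)
  have hr0 : 0 < r := Real.sqrt_pos.2 (by positivity)
  set s := r / v with hs
  have hs0 : 0 < s := div_pos hr0 hv
  have hsr : s * r = 2 * l := by rw [hs]; field_simp; linarith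
  have hs2 : s ^ 2 * v = 2 * l := by rw [hs]; field_simp; linarith
  have hexp (y : EuclideanSpace ℝ (Fin n)) : Real.exp (s * (⟪u, y⟫ - t)) +
      Real.exp (-(s * (⟪u, y⟫ - t))) =
      Real.exp (-(s * t)) * Real.exp ⟪s • u, y⟫ + Real.exp (s * t) * Real.exp ⟪(-s) • u, y⟫ := by
    rw [← Real.exp_add, ← Real.exp_add, real_inner_smul_left, real_inner_smul_left]
    congr 2 <;> ring
  have hint1 := (integrable_exp_inner (σ := σ) (m := m) (s • u)).const_mul (Real.exp (-(s * t)))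
  have hint2 := (integrable_exp_inner (σ := σ) (m := m) ((-s) • u)).const_mul (Real.exp (s * t))
  have hint : Integrable (fun y => Real.exp (s * (⟪u, y⟫ - t)) +
      Real.exp (-(s * (⟪u, y⟫ - t)))) P := by
    simp_rw [hexp]
    exact hint1.add hint2
  have hval : ∫ y, (Real.exp (s * (⟪u, y⟫ - t)) + Real.exp (-(s * (⟪u, y⟫ - t)))) ∂P ≤
      2 * Real.exp l := by
    simp_rw [hexp]
    rw [integral_add hint1 hint2, integral_const_mul, integral_const_mul, integral_exp_inner,
      integral_exp_inner, ← Real.exp_add, ← Real.exp_add, real_inner_smul_left,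
      real_inner_smul_left, hm, norm_smul, norm_smul, mul_pow, mul_pow, norm_neg, Real.norm_eq_abs,
      sq_abs]
    have hle : σ ^ 2 * (s ^ 2 * ‖u‖ ^ 2) / 2 ≤ l := by nlinarith [sq_nonneg s]
    have h1 : Real.exp (-(s * t) + (s * t + σ ^ 2 * (s ^ 2 * ‖u‖ ^ 2) / 2)) ≤ Real.exp l :=
      Real.exp_le_exp.2 (by linarith)
    have h2 : Real.exp (s * t + (-s * t + σ ^ 2 * (s ^ 2 * ‖u‖ ^ 2) / 2)) ≤ Real.exp l :=
      Real.exp_le_exp.2 (by linarith)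
    linarith
  set C := 4 / s ^ 2 * Real.exp (-(s * r)) with hC
  have hC0 : 0 ≤ C := by positivity
  have hbd : Integrable (fun y => 8 * min (t ^ 2) (r ^ 2) + C * (Real.exp (s * (⟪u, y⟫ - t)) +
      Real.exp (-(s * (⟪u, y⟫ - t))))) P := (integrable_const _).add (hint.const_mul C)
  have hmin0 : 0 ≤ min (t ^ 2) (r ^ 2) := le_min (sq_nonneg _) (sq_nonneg _)
  calc _ ≤ ∫⁻ y, ENNReal.ofReal (8 * min (t ^ 2) (r ^ 2) + C * (Real.exp (s * (⟪u, y⟫ - t)) +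
      Real.exp (-(s * (⟪u, y⟫ - t))))) ∂P :=
        lintegral_mono fun y => ENNReal.ofReal_le_ofReal (softThreshold_sub_sq_le hr0.le hs0 t _)
    _ = ENNReal.ofReal (8 * min (t ^ 2) (r ^ 2) + C * ∫ y, (Real.exp (s * (⟪u, y⟫ - t)) +
      Real.exp (-(s * (⟪u, y⟫ - t)))) ∂P) := by
        rw [← ofReal_integral_eq_lintegral_ofReal hbd (.of_forall fun y => by positivity),
          integral_add (integrable_const _) (hint.const_mul C),
          integral_const_mul C]
        simp
    _ ≤ _ := by
        apply ENNReal.ofReal_le_ofReal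
        rw [hr2]
        have h1 : C * ∫ y, (Real.exp (s * (⟪u, y⟫ - t)) + Real.exp (-(s * (⟪u, y⟫ - t)))) ∂P ≤
            C * (2 * Real.exp l) := mul_le_mul_of_nonneg_left hval hC0
        have h2 : C * (2 * Real.exp l) = 8 / s ^ 2 * Real.exp (-l) := by
          have : Real.exp (-(s * r)) * Real.exp l = Real.exp (-l) := by
            rw [← Real.exp_add, hsr]
            congr 1
            ring
          rw [hC, ← this]
          ring
        have h3 : 8 / s ^ 2 ≤ 4 * v := by
          rw [div_le_iff₀ (by positivity)]
          nlinarith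
        have h4 := mul_le_mul_of_nonneg_right h3 (Real.exp_pos (-l)).le
        linarith

/-- Soft thresholding of the least squares estimator at the level `√(2 v l)`, `v = σ² B / n`. -/
theorem minimaxRisk_le {p R B l C : ℝ} (hn : 0 < n) (hσ : 0 < σ) (hB : 0 < B) (hl : 1 ≤ l)
    (hC : ∀ θ ∈ lpBall d p R, ∑ i, min (θ i ^ 2) (2 * (σ ^ 2 * B / n) * l) ≤ C) :
    minimaxRisk n d p σ R B ≤
      ENNReal.ofReal (8 * C + 4 * (d * (σ ^ 2 * B / n) * Real.exp (-l))) := by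
  have hn' : (0 : ℝ) < n := by exact_mod_cast hn
  have hdual (X : Matrix (Fin n) (Fin d) ℝ) : ∃ u : Fin d → EuclideanSpace ℝ (Fin n),
      X ∈ designClass n d B →
        ∀ i, (∀ θ, ⟪u i, Matrix.toEuclideanLin X θ⟫ = θ i) ∧ ‖u i‖ ^ 2 ≤ (n / B)⁻¹ := by
    by_cases hX : X ∈ designClass n d B
    · choose u hu using exists_dual_vector (div_pos hn' hB) (Matrix.toEuclideanLin X)
        (mul_sq_norm_le_of_mem_designClass hn hX)
      exact ⟨u, fun _ => hu⟩
    · exact ⟨0, fun h => absurd h hX⟩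
  choose u hu using hdual
  set v := σ ^ 2 * B / n with hv
  have hv0 : 0 < v := by positivity
  refine iInf₂_le_of_le (fun X y => WithLp.toLp 2 fun i => softThreshold (√(2 * v * l)) ⟪u X i, y⟫)
    (fun X => ?_) ?_
  · refine (WithLp.measurable_toLp _ _).comp (measurable_pi_lambda _ fun i => ?_)
    exact (measurable_softThreshold _).comp (by fun_prop)
  refine iSup₂_le fun X hX => iSup₂_le fun θ hθ => ?_
  have hcoord (i : Fin d) := lintegral_softThreshold_le (σ := σ) (t := θ i)
    (m := Matrix.toEuclideanLin X θ) (u := u X i) hv0 hl (by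
      calc σ ^ 2 * ‖u X i‖ ^ 2 ≤ σ ^ 2 * (n / B)⁻¹ := by gcongr; exact (hu X hX i).2
        _ = v := by rw [hv]; field_simp) ((hu X hX i).1 θ)
  have hmeas (i : Fin d) : Measurable fun y : EuclideanSpace ℝ (Fin n) =>
      ENNReal.ofReal ((softThreshold (√(2 * v * l)) ⟪u X i, y⟫ - θ i) ^ 2) :=
    ((((measurable_softThreshold _).comp (by fun_prop)).sub_const _).pow_const 2).ennreal_ofReal
  have hpos (i : Fin d) : 0 ≤ 8 * min (θ i ^ 2) (2 * v * l) + 4 * v * Real.exp (-l) := by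
    have : 0 ≤ min (θ i ^ 2) (2 * v * l) := le_min (sq_nonneg _) (by positivity)
    positivity
  calc risk σ _ X θ = ∑ i, ∫⁻ y, ENNReal.ofReal
        ((softThreshold (√(2 * v * l)) ⟪u X i, y⟫ - θ i) ^ 2) ∂(obsLaw σ X θ) := by
        rw [risk, ← lintegral_finsetSum _ fun i _ => hmeas i]
        refine lintegral_congr fun y => ?_
        rw [EuclideanSpace.real_norm_sq_eq, ENNReal.ofReal_sum_of_nonneg fun i _ => sq_nonneg _]
        rfl
    _ ≤ ∑ i, ENNReal.ofReal (8 * min (θ i ^ 2) (2 * v * l) + 4 * v * Real.exp (-l)) :=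
        Finset.sum_le_sum fun i _ => hcoord i
    _ = ENNReal.ofReal (8 * (∑ i, min (θ i ^ 2) (2 * v * l)) + 4 * (d * v * Real.exp (-l))) := by
        rw [← ENNReal.ofReal_sum_of_nonneg fun i _ => hpos i, Finset.sum_add_distrib,
          Finset.mul_sum, Finset.sum_const, Finset.card_univ, Fintype.card_fin, nsmul_eq_mul]
        ring_nf
    _ ≤ _ := by
        apply ENNReal.ofReal_le_ofReal
        linarith [hC θ hθ]

end UpperBound

/-! ### Bayes risk of independent block spikes -/

section LowerBound

variable {n d k m : ℕ} {σ a : ℝ}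

theorem ofReal_integral_le_lintegral {Ω : Type*} [MeasurableSpace Ω] {P : Measure Ω}
    {f g : Ω → ℝ} (hg : Integrable g P) (h : ∀ x, g x ≤ f x) :
    ENNReal.ofReal (∫ x, g x ∂P) ≤ ∫⁻ x, ENNReal.ofReal (f x) ∂P := by
  calc ENNReal.ofReal (∫ x, g x ∂P) ≤ ENNReal.ofReal (∫ x, max (g x) 0 ∂P) :=
        ENNReal.ofReal_le_ofReal (integral_mono hg hg.pos_part fun x => le_max_left _ _)
    _ = ∫⁻ x, ENNReal.ofReal (max (g x) 0) ∂P :=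
        ofReal_integral_eq_lintegral_ofReal hg.pos_part (.of_forall fun x => le_max_right _ _)
    _ ≤ _ := lintegral_mono fun x => by
        rw [ENNReal.ofReal_max, ENNReal.ofReal_zero, max_eq_left zero_le]
        exact ENNReal.ofReal_le_ofReal (h x)

/-- A pointwise lower bound for the posterior loss when the parameter is either `0` or one of the
spikes `a e_j`, at distance `a` from `0`, with likelihood ratios `L j`. It is quadratic in `L`, with
the free slope `w`, so that only second moments of `L` are needed after integration. -/
theorem spike_loss_ge (hm : 0 < m) {w : ℝ} (hw : 0 ≤ w) (ha : 0 ≤ a) (L : Fin m → ℝ)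
    (hL : ∀ j, 0 ≤ L j) (T : EuclideanSpace ℝ (Fin m)) :
    2 * a * w * (∑ j, L j) - ((∑ j, L j) ^ 2 / m + ∑ j, L j) * w ^ 2 ≤
      m * ‖T‖ ^ 2 + ∑ j, L j * ‖T - EuclideanSpace.single j a‖ ^ 2 := by
  have hm' : (0 : ℝ) < m := by exact_mod_cast hm
  set S := ∑ j, L j with hS
  have h1 : 2 * S * w * ‖T‖ - S ^ 2 * w ^ 2 / m ≤ m * ‖T‖ ^ 2 := by
    rw [sub_le_iff_le_add, ← sub_le_iff_le_add', le_div_iff₀ hm']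
    nlinarith [sq_nonneg (m * ‖T‖ - S * w)]
  have h2 : ∑ j, L j * (2 * w * (a - ‖T‖) - w ^ 2) ≤
      ∑ j, L j * ‖T - EuclideanSpace.single j a‖ ^ 2 := by
    refine Finset.sum_le_sum fun j _ => mul_le_mul_of_nonneg_left ?_ (hL j)
    have h3 : a ≤ ‖T‖ + ‖T - EuclideanSpace.single j a‖ := by
      calc a = ‖EuclideanSpace.single j a‖ := by
            rw [PiLp.norm_single, Real.norm_of_nonneg ha]
        _ = ‖T - (T - EuclideanSpace.single j a)‖ := by rw [sub_sub_cancel]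
        _ ≤ _ := norm_sub_le _ _
    nlinarith [sq_nonneg (‖T - EuclideanSpace.single j a‖ - w)]
  rw [← Finset.sum_mul, ← hS] at h2
  have h4 : S ^ 2 / m * w ^ 2 = S ^ 2 * w ^ 2 / m := by ring
  rw [add_mul, h4]
  linarith

/-- Detecting and locating a single spike among `m` orthogonal directions `h j` in Gaussian noise:
if `exp (‖h j‖² / σ²) ≤ 1 + m`, then the average likelihood ratio has second moment at most `2`, and
no estimator does better than a constant multiple of `a²`. -/
theorem spike_risk_ge (hσ : 0 < σ) (ha : 0 ≤ a) (hm : 0 < m) {q : ℝ}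
    (hq : Real.exp (q / σ ^ 2) ≤ 1 + m) (μ : EuclideanSpace ℝ (Fin n))
    (h : Fin m → EuclideanSpace ℝ (Fin n)) (hself : ∀ j, ‖h j‖ ^ 2 = q)
    (horth : ∀ i j, i ≠ j → ⟪h i, h j⟫ = 0)
    (T : EuclideanSpace ℝ (Fin n) → EuclideanSpace ℝ (Fin m)) (hT : Measurable T) :
    ENNReal.ofReal (m * a ^ 2 / 3) ≤
      m * ∫⁻ y, ENNReal.ofReal (‖T y‖ ^ 2)
        ∂(multivariateGaussian μ ((σ ^ 2) • (1 : Matrix (Fin n) (Fin n) ℝ))) +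
      ∑ j, ∫⁻ y, ENNReal.ofReal (‖T y - EuclideanSpace.single j a‖ ^ 2)
        ∂(multivariateGaussian (μ + h j) ((σ ^ 2) • (1 : Matrix (Fin n) (Fin n) ℝ))) := by
  have hm' : (0 : ℝ) < m := by exact_mod_cast hm
  set P := multivariateGaussian μ ((σ ^ 2) • (1 : Matrix (Fin n) (Fin n) ℝ)) with hP
  set L : Fin m → EuclideanSpace ℝ (Fin n) → ℝ := fun j y => shiftDensity σ μ (h j) y with hL
  have hLmeas (j : Fin m) : Measurable fun y => ENNReal.ofReal (L j y) :=
    (measurable_shiftDensity _ _).ennreal_ofReal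
  have hmeas (j : Fin m) : Measurable fun y =>
      ENNReal.ofReal (‖T y - EuclideanSpace.single j a‖ ^ 2) :=
    ((hT.sub_const _).norm.pow_const 2).ennreal_ofReal
  have hmeas0 : Measurable fun y => ENNReal.ofReal (‖T y‖ ^ 2) :=
    (hT.norm.pow_const 2).ennreal_ofReal
  have hsum : m * ∫⁻ y, ENNReal.ofReal (‖T y‖ ^ 2) ∂P +
      ∑ j, ∫⁻ y, ENNReal.ofReal (‖T y - EuclideanSpace.single j a‖ ^ 2)
        ∂(multivariateGaussian (μ + h j) ((σ ^ 2) • (1 : Matrix (Fin n) (Fin n) ℝ))) =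
      ∫⁻ y, ENNReal.ofReal (m * ‖T y‖ ^ 2 +
        ∑ j, L j y * ‖T y - EuclideanSpace.single j a‖ ^ 2) ∂P := by
    have h1 (y : EuclideanSpace ℝ (Fin n)) : ENNReal.ofReal (m * ‖T y‖ ^ 2 +
        ∑ j, L j y * ‖T y - EuclideanSpace.single j a‖ ^ 2) = m * ENNReal.ofReal (‖T y‖ ^ 2) +
        ∑ j, ENNReal.ofReal (L j y) * ENNReal.ofReal (‖T y - EuclideanSpace.single j a‖ ^ 2) := by
      have h0 (j : Fin m) : 0 ≤ L j y * ‖T y - EuclideanSpace.single j a‖ ^ 2 :=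
        mul_nonneg (shiftDensity_nonneg _ _ _) (sq_nonneg _)
      rw [ENNReal.ofReal_add (by positivity) (Finset.sum_nonneg fun j _ => h0 j),
        ENNReal.ofReal_mul hm'.le, ENNReal.ofReal_natCast,
        ENNReal.ofReal_sum_of_nonneg fun j _ => h0 j]
      congr 1
      exact Finset.sum_congr rfl fun j _ => ENNReal.ofReal_mul (shiftDensity_nonneg _ _ _)
    simp_rw [h1]
    rw [lintegral_add_left (hmeas0.const_mul _), lintegral_const_mul _ hmeas0]
    congr 1
    refine Eq.trans ?_ (lintegral_finsetSum _ fun j _ => (hLmeas j).mul (hmeas j)).symm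
    refine Finset.sum_congr rfl fun j _ => ?_
    rw [← withDensity_shiftDensity hσ, lintegral_withDensity_eq_lintegral_mul _ (hLmeas j) (hmeas j)]
  rw [hsum]
  have hLint (j : Fin m) : Integrable (L j) P := integrable_shiftDensity _ _
  have hSint : Integrable (fun y => ∑ j, L j y) P := integrable_finsetSum _ fun j _ => hLint j
  have hSS (y : EuclideanSpace ℝ (Fin n)) :
      (∑ j, L j y) ^ 2 = ∑ i, ∑ j, L i y * L j y := by rw [sq, Finset.sum_mul_sum]
  have hLLint (i j : Fin m) : Integrable (fun y => L i y * L j y) P :=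
    integrable_shiftDensity_mul hσ _ _ _
  have hS2int : Integrable (fun y => (∑ j, L j y) ^ 2) P := by
    simp_rw [hSS]
    exact integrable_finsetSum _ fun i _ => integrable_finsetSum _ fun j _ => hLLint i j
  have hS : ∫ y, ∑ j, L j y ∂P = m := by
    rw [integral_finsetSum _ fun j _ => hLint j]
    simp_rw [hL, hP, integral_shiftDensity hσ]
    simp
  have hS2 : ∫ y, (∑ j, L j y) ^ 2 ∂P ≤ 2 * m ^ 2 := by
    simp_rw [hSS]
    rw [integral_finsetSum _ fun i _ => integrable_finsetSum _ fun j _ => hLLint i j]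
    have hrow (i : Fin m) : ∫ y, ∑ j, L i y * L j y ∂P ≤ 2 * m := by
      rw [integral_finsetSum _ fun j _ => hLLint i j]
      simp_rw [hL, hP, integral_shiftDensity_mul hσ]
      rw [← Finset.add_sum_erase _ _ (Finset.mem_univ i), real_inner_self_eq_norm_sq, hself]
      have h1 : ∑ j ∈ Finset.univ.erase i, Real.exp (⟪h i, h j⟫ / σ ^ 2) = m - 1 := by
        rw [Finset.sum_congr rfl (g := fun _ => (1 : ℝ)) fun j hj => by
          rw [horth i j (Finset.ne_of_mem_erase hj).symm, zero_div, Real.exp_zero]]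
        rw [Finset.sum_const, Finset.card_erase_of_mem (Finset.mem_univ i), Finset.card_univ,
          Fintype.card_fin, nsmul_one, Nat.cast_sub hm, Nat.cast_one]
      rw [h1]
      linarith
    calc _ ≤ ∑ _i : Fin m, 2 * (m : ℝ) := Finset.sum_le_sum fun i _ => hrow i
      _ = _ := by simp; ring
  have hVint : Integrable (fun y => (∑ j, L j y) ^ 2 / m + ∑ j, L j y) P :=
    (hS2int.div_const _).add hSint
  -- The slope `w = a / 3` maximizes the resulting bound `m (2 a w - 3 w²)`.
  refine le_trans (ENNReal.ofReal_le_ofReal ?_) (ofReal_integral_le_lintegral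
    (g := fun y => 2 * a * (a / 3) * (∑ j, L j y) -
      ((∑ j, L j y) ^ 2 / m + ∑ j, L j y) * (a / 3) ^ 2) ?_
    fun y => spike_loss_ge hm (by positivity) ha (fun j => L j y)
      (fun j => shiftDensity_nonneg _ _ _) (T y))
  · rw [integral_sub (hSint.const_mul _) (hVint.mul_const _), integral_const_mul,
      integral_mul_const, integral_add (hS2int.div_const _) hSint, integral_div, hS]
    have h1 : (∫ y, (∑ j, L j y) ^ 2 ∂P) / m ≤ 2 * m := by
      rw [div_le_iff₀ hm']
      linarith
    have h2 := mul_le_mul_of_nonneg_right h1 (sq_nonneg (a / 3))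
    nlinarith
  · exact (hSint.const_mul _).sub (hVint.mul_const _)

/-- The parameter with at most one entry `a` per block: coordinates are indexed by
`ι (block, position)`, the position of the spike in block `b` is `(c b).1`, and the spike is present
if and only if `(c b).2` is true. -/
def spikes (ι : Fin k × Fin m ↪ Fin d) (a : ℝ) (c : Fin k → Fin m × Bool) :
    EuclideanSpace ℝ (Fin d) :=
  WithLp.toLp 2 fun i => if ∃ b, ι (b, (c b).1) = i ∧ (c b).2 = true then a else 0

theorem spikes_apply (ι : Fin k × Fin m ↪ Fin d) (a : ℝ) (c : Fin k → Fin m × Bool) (b : Fin k)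
    (j : Fin m) : spikes ι a c (ι (b, j)) = if c b = (j, true) then a else 0 := by
  have : (∃ b', ι (b', (c b').1) = ι (b, j) ∧ (c b').2 = true) ↔ c b = (j, true) := by
    constructor
    · rintro ⟨b', h1, h2⟩
      obtain ⟨rfl, h3⟩ := Prod.ext_iff.1 (ι.injective h1)
      exact Prod.ext h3 h2
    · intro h
      exact ⟨b, by rw [h], by rw [h]⟩
  simp only [spikes, this]

theorem card_support_spikes_le (ι : Fin k × Fin m ↪ Fin d) (a : ℝ) (c : Fin k → Fin m × Bool) :
    (Finset.univ.filter fun i => spikes ι a c i ≠ 0).card ≤ k := by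
  calc _ ≤ (Finset.univ.image fun b => ι (b, (c b).1)).card := by
        refine Finset.card_le_card fun i hi => ?_
        by_contra h
        refine (Finset.mem_filter.1 hi).2 (if_neg ?_)
        rintro ⟨b, hb, -⟩
        exact h (Finset.mem_image.2 ⟨b, Finset.mem_univ _, hb⟩)
    _ ≤ _ := Finset.card_image_le.trans (by simp)

theorem sum_abs_rpow_spikes_le (ι : Fin k × Fin m ↪ Fin d) (ha : 0 ≤ a) {p : ℝ} (hp : 0 < p)
    (c : Fin k → Fin m × Bool) : ∑ i, |spikes ι a c i| ^ p ≤ k * a ^ p := by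
  rw [← Finset.sum_filter_of_ne (p := fun i => spikes ι a c i ≠ 0)]
  · refine (Finset.sum_le_card_nsmul _ _ (a ^ p) fun i _ => ?_).trans ?_
    · refine Real.rpow_le_rpow (abs_nonneg _) ?_ hp.le
      simp only [spikes]
      split_ifs
      · rw [abs_of_nonneg ha]
      · simpa using ha
    · rw [nsmul_eq_mul]
      gcongr
      exact card_support_spikes_le ι a c
  · intro i _ h h0
    rw [h0, abs_zero, Real.zero_rpow hp.ne'] at h
    exact h rfl

/-- Switching on the spike in block `b`. -/
theorem spikes_update (ι : Fin k × Fin m ↪ Fin d) (a : ℝ) (c : Fin k → Fin m × Bool) (b : Fin k)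
    (j i : Fin m) : spikes ι a (Function.update c b (j, true)) =
      spikes ι a (Function.update c b (i, false)) + EuclideanSpace.single (ι (b, j)) a := by
  ext x
  by_cases hx : ∃ z, ι z = x
  · obtain ⟨⟨b', j'⟩, rfl⟩ := hx
    rw [PiLp.add_apply, spikes_apply, spikes_apply, PiLp.single_apply]
    rcases eq_or_ne b' b with rfl | hb
    · simp only [Function.update_self, Prod.mk.injEq, and_true, Bool.false_eq_true, and_false,
        if_false, zero_add, EmbeddingLike.apply_eq_iff_eq, true_and]
      exact if_congr eq_comm rfl rfl
    · simp [hb]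
  · have h0 (c' : Fin k → Fin m × Bool) : spikes ι a c' x = 0 :=
      if_neg fun ⟨b', h, _⟩ => hx ⟨_, h⟩
    rw [PiLp.add_apply, h0, h0, PiLp.single_apply, if_neg fun h => hx ⟨_, h.symm⟩,
      add_zero]

/-- The design with equality in the constraint: a multiple of the first `d` columns of the identity. -/
def scaledIdentity (n d : ℕ) (B : ℝ) : Matrix (Fin n) (Fin d) ℝ :=
  Matrix.of fun i j => if (i : ℕ) = j then √(n / B) else 0

theorem scaledIdentity_gram {B : ℝ} (hB : 0 < B) (hdn : d ≤ n) :
    (scaledIdentity n d B).transpose * scaledIdentity n d B =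
      ((n : ℝ) / B) • (1 : Matrix (Fin d) (Fin d) ℝ) := by
  ext i j
  rw [Matrix.mul_apply, Finset.sum_eq_single (Fin.castLE hdn i)]
  · rcases eq_or_ne i j with rfl | hij
    · have : √((n : ℝ) / B) * √(n / B) = n / B := Real.mul_self_sqrt (by positivity)
      simpa [scaledIdentity, -Real.sqrt_div', -Real.sqrt_div] using this
    · have : (i : ℕ) ≠ j := fun h => hij (Fin.ext h)
      simp [scaledIdentity, hij, this]
  · intro l _ hl
    have : (l : ℕ) ≠ i := fun h => hl (Fin.ext h)
    simp [scaledIdentity, this]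
  · simp

theorem scaledIdentity_mem {B : ℝ} (hB : 0 < B) (hn : 0 < n) (hdn : d ≤ n) :
    scaledIdentity n d B ∈ designClass n d B := by
  change Matrix.PosSemidef _
  have hn' : (n : ℝ) ≠ 0 := by positivity
  rw [scaledIdentity_gram hB hdn, smul_smul, show 1 / (n : ℝ) * (n / B) = 1 / B by field_simp,
    sub_self]
  exact .zero

theorem inner_scaledIdentity {B : ℝ} (hB : 0 < B) (hdn : d ≤ n) (x y : EuclideanSpace ℝ (Fin d)) :
    ⟪Matrix.toEuclideanLin (scaledIdentity n d B) x,
      Matrix.toEuclideanLin (scaledIdentity n d B) y⟫ = n / B * ⟪x, y⟫ := by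
  rw [EuclideanSpace.inner_eq_star_dotProduct, EuclideanSpace.inner_eq_star_dotProduct]
  simp only [Matrix.ofLp_toLpLin, Matrix.toLin'_apply, star_trivial]
  rw [← Matrix.vecMul_transpose, ← Matrix.dotProduct_mulVec, dotProduct_comm]
  rw [Matrix.mulVec_mulVec, scaledIdentity_gram hB hdn]
  simp [Matrix.smul_mulVec, dotProduct_comm]

/-- The risk of `θhat` over the coordinates of block `b`. -/
def blockRisk (σ : ℝ) (X : Matrix (Fin n) (Fin d) ℝ)
    (T : EuclideanSpace ℝ (Fin n) → EuclideanSpace ℝ (Fin d)) (ι : Fin k × Fin m ↪ Fin d) (a : ℝ)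
    (b : Fin k) (c : Fin k → Fin m × Bool) : ℝ≥0∞ :=
  ∫⁻ y, ENNReal.ofReal (∑ j, (T y (ι (b, j)) - spikes ι a c (ι (b, j))) ^ 2)
    ∂(obsLaw σ X (spikes ι a c))

/-- For given spikes in the other blocks, the Bayes risk over block `b` is at least `a ^ 2 / 6`: the
sum runs over the `2 * m` equally likely states of the block, half of which have no spike. -/
theorem sum_blockRisk_update_ge {B : ℝ} (hσ : 0 < σ) (hB : 0 < B) (hdn : d ≤ n) (ha : 0 ≤ a)
    (hm : 0 < m) (ham : a ^ 2 ≤ σ ^ 2 * B / n * Real.log (1 + m)) (hn : 0 < n)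
    (T : EuclideanSpace ℝ (Fin n) → EuclideanSpace ℝ (Fin d)) (hT : Measurable T)
    (ι : Fin k × Fin m ↪ Fin d) (b : Fin k) (c : Fin k → Fin m × Bool) :
    ENNReal.ofReal (m * a ^ 2 / 3) ≤
      ∑ x, blockRisk σ (scaledIdentity n d B) T ι a b (Function.update c b x) := by
  have hn' : (0 : ℝ) < n := by exact_mod_cast hn
  set A := Matrix.toEuclideanLin (scaledIdentity n d B) with hA
  set j₀ : Fin m := ⟨0, hm⟩
  set θ := spikes ι a (Function.update c b (j₀, false)) with hθ
  have hinner (i j : Fin m) : ⟪A (EuclideanSpace.single (ι (b, i)) a),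
      A (EuclideanSpace.single (ι (b, j)) a)⟫ = if i = j then n / B * a ^ 2 else 0 := by
    rw [hA, inner_scaledIdentity hB hdn, EuclideanSpace.inner_single_left,
      PiLp.single_apply]
    by_cases hij : i = j
    · simp [hij, sq]
    · simp [hij]
  have hTb : Measurable fun y => (WithLp.toLp 2 fun j => T y (ι (b, j)) :
      EuclideanSpace ℝ (Fin m)) :=
    (WithLp.measurable_toLp _ _).comp (measurable_pi_lambda _ fun j =>
      (EuclideanSpace.proj (𝕜 := ℝ) (ι (b, j))).continuous.measurable.comp hT)
  have key := spike_risk_ge hσ ha hm (q := n / B * a ^ 2) ?_ (A θ)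
    (fun j => A (EuclideanSpace.single (ι (b, j)) a))
    (fun j => by rw [← real_inner_self_eq_norm_sq, hinner, if_pos rfl])
    (fun i j hij => by rw [hinner, if_neg hij]) _ hTb
  · refine key.trans_eq ?_
    rw [Fintype.sum_prod_type_right]
    simp only [Fintype.sum_bool]
    rw [add_comm]
    congr 1
    · refine Finset.sum_congr rfl fun j _ => ?_
      rw [blockRisk, obsLaw, spikes_update ι a c b j j₀, ← hθ, ← hA, map_add]
      refine lintegral_congr fun y => ?_
      rw [EuclideanSpace.real_norm_sq_eq]
      congr 1
      refine Finset.sum_congr rfl fun i _ => ?_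
      rw [← spikes_update, spikes_apply, Function.update_self, PiLp.sub_apply,
        PiLp.single_apply]
      simp [eq_comm]
    · have h1 (j : Fin m) : spikes ι a (Function.update c b (j, false)) = θ :=
        add_right_cancel ((spikes_update ι a c b j₀ j).symm.trans (spikes_update ι a c b j₀ j₀))
      simp only [blockRisk, h1, obsLaw, ← hA]
      rw [Finset.sum_const, Finset.card_univ, Fintype.card_fin, nsmul_eq_mul]
      congr 1
      refine lintegral_congr fun y => ?_
      rw [EuclideanSpace.real_norm_sq_eq]
      congr 1
      refine Finset.sum_congr rfl fun i _ => ?_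
      rw [hθ, spikes_apply, Function.update_self]
      simp
  · rw [← Real.le_log_iff_exp_le (by positivity)]
    calc n / B * a ^ 2 / σ ^ 2 ≤ n / B * (σ ^ 2 * B / n * Real.log (1 + m)) / σ ^ 2 := by gcongr
      _ = _ := by field_simp

/-- Resampling one coordinate of a uniformly distributed function leaves the average unchanged. -/
theorem sum_update_eq {ι β : Type*} [Fintype ι] [DecidableEq ι] [Fintype β]
    (F : (ι → β) → ℝ≥0∞) (b : ι) :
    ∑ c, ∑ x, F (Function.update c b x) = Fintype.card β * ∑ c, F c := by
  have hinv : Function.Involutive fun z : (ι → β) × β => (Function.update z.1 b z.2, z.1 b) := by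
    rintro ⟨c, x⟩
    simp
  calc ∑ c, ∑ x, F (Function.update c b x) = ∑ z : (ι → β) × β, F (Function.update z.1 b z.2) :=
        (Fintype.sum_prod_type' _).symm
    _ = ∑ z : (ι → β) × β, F z.1 := Fintype.sum_equiv hinv.toPerm _ _ fun _ => rfl
    _ = _ := by
        rw [Fintype.sum_prod_type]
        simp [Finset.mul_sum]

/-- The Bayes risk of the uniform prior on the vectors `spikes ι a c`. -/
theorem minimaxRisk_ge {p R B : ℝ} (hσ : 0 < σ) (hB : 0 < B) (hn : 0 < n) (hdn : d ≤ n)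
    (ha : 0 ≤ a) (hm : 0 < m) (hkm : k * m ≤ d)
    (ham : a ^ 2 ≤ σ ^ 2 * B / n * Real.log (1 + m))
    (hmem : ∀ (ι : Fin k × Fin m ↪ Fin d) c, spikes ι a c ∈ lpBall d p R) :
    ENNReal.ofReal (k * a ^ 2 / 6) ≤ minimaxRisk n d p σ R B := by
  have hm' : (0 : ℝ) < m := by exact_mod_cast hm
  let ι : Fin k × Fin m ↪ Fin d :=
    finProdFinEquiv.toEmbedding.trans (Fin.castLEEmb hkm)
  refine le_iInf₂ fun θhat hθhat => ?_
  set X := scaledIdentity n d B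
  set M := ⨆ X ∈ designClass n d B, ⨆ θ ∈ lpBall d p R, risk σ θhat X θ
  have hM (c : Fin k → Fin m × Bool) : risk σ θhat X (spikes ι a c) ≤ M :=
    (le_iSup₂_of_le (spikes ι a c) (hmem ι c) le_rfl).trans
      (le_iSup₂ (f := fun X _ => ⨆ θ ∈ lpBall d p R, risk σ θhat X θ) X
        (scaledIdentity_mem hB hn hdn))
  have hblocks (c : Fin k → Fin m × Bool) :
      ∑ b, blockRisk σ X (θhat X) ι a b c ≤ risk σ θhat X (spikes ι a c) := by
    have hmeas (i : Fin d) : Measurable fun y => θhat X y i :=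
      (EuclideanSpace.proj (𝕜 := ℝ) i).continuous.measurable.comp (hθhat X)
    simp only [blockRisk]
    rw [← lintegral_finsetSum, risk]
    · refine lintegral_mono fun y => ?_
      rw [← ENNReal.ofReal_sum_of_nonneg fun b _ => Finset.sum_nonneg fun j _ => sq_nonneg _]
      apply ENNReal.ofReal_le_ofReal
      rw [EuclideanSpace.real_norm_sq_eq, ← Fintype.sum_prod_type',
        ← Finset.sum_map Finset.univ ι fun i => (θhat X y i - spikes ι a c i) ^ 2]
      exact Finset.sum_le_sum_of_subset_of_nonneg (Finset.subset_univ _)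
        fun i _ _ => sq_nonneg _
    · intro b _
      refine (Finset.measurable_sum _ fun j _ => ?_).ennreal_ofReal
      exact Measurable.pow_const (Measurable.sub_const (hmeas (ι (b, j))) _) 2
  set N := Fintype.card (Fin k → Fin m × Bool)
  have hN0 : (N : ℝ≥0∞) ≠ 0 := by
    have : Nonempty (Fin m) := ⟨⟨0, hm⟩⟩
    exact_mod_cast Fintype.card_ne_zero
  have hb (b : Fin k) : N * ENNReal.ofReal (a ^ 2 / 6) ≤
      ∑ c, blockRisk σ X (θhat X) ι a b c := by
    have h1 : N * ENNReal.ofReal (m * a ^ 2 / 3) ≤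
        (2 * m : ℕ) * ∑ c, blockRisk σ X (θhat X) ι a b c := by
      have h2 := sum_update_eq (blockRisk σ X (θhat X) ι a b) b
      rw [Fintype.card_prod, Fintype.card_fin, Fintype.card_bool, mul_comm m 2] at h2
      rw [← h2]
      calc (N : ℝ≥0∞) * ENNReal.ofReal (m * a ^ 2 / 3) =
          ∑ _c : Fin k → Fin m × Bool, ENNReal.ofReal (m * a ^ 2 / 3) := by
            rw [Finset.sum_const, Finset.card_univ, nsmul_eq_mul]
        _ ≤ _ := Finset.sum_le_sum fun c _ =>
            sum_blockRisk_update_ge hσ hB hdn ha hm ham hn _ (hθhat X) ι b c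
    have h3 : ENNReal.ofReal (m * a ^ 2 / 3) = (2 * m : ℕ) * ENNReal.ofReal (a ^ 2 / 6) := by
      rw [← ENNReal.ofReal_natCast, ← ENNReal.ofReal_mul (by positivity)]
      congr 1
      push_cast
      ring
    rw [h3, mul_left_comm] at h1
    exact (ENNReal.mul_le_mul_iff_right (by exact_mod_cast (by omega))
      (ENNReal.natCast_ne_top _)).1 h1
  have hfinal : N * ENNReal.ofReal (k * a ^ 2 / 6) ≤ N * M := by
    calc N * ENNReal.ofReal (k * a ^ 2 / 6) = ∑ _b : Fin k, N * ENNReal.ofReal (a ^ 2 / 6) := by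
          rw [Finset.sum_const, Finset.card_univ, Fintype.card_fin, nsmul_eq_mul, mul_left_comm,
            mul_div_assoc, ENNReal.ofReal_mul (by positivity), ENNReal.ofReal_natCast]
      _ ≤ ∑ b, ∑ c, blockRisk σ X (θhat X) ι a b c := Finset.sum_le_sum fun b _ => hb b
      _ = ∑ c, ∑ b, blockRisk σ X (θhat X) ι a b c := Finset.sum_comm
      _ ≤ ∑ _c : Fin k → Fin m × Bool, M := Finset.sum_le_sum fun c _ => (hblocks c).trans (hM c)
      _ = N * M := by rw [Finset.sum_const, Finset.card_univ, nsmul_eq_mul]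
  exact (ENNReal.mul_le_mul_iff_right hN0 (by simp)).1 hfinal

end LowerBound

/-! ### The minimax rates -/

section Rates

/-- Follows from `log x ≤ log (1 + m)` and `1 ≤ 3 / 2 * log 2 ≤ 3 / 2 * log (1 + m)`. -/
theorem log_le_log_one_add {x : ℝ} {m : ℕ} (hm0 : 0 < m) (hx : 1 ≤ x) (hm : x ≤ 1 + m) :
    Real.log (Real.exp 1 * x) ≤ 5 / 2 * Real.log (1 + m) := by
  have hm1 : (1 : ℝ) ≤ m := by exact_mod_cast hm0
  rw [Real.log_mul (Real.exp_pos 1).ne' (by positivity), Real.log_exp]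
  have h1 : Real.log x ≤ Real.log (1 + m) := Real.log_le_log (by linarith) hm
  have h2 : Real.log 2 ≤ Real.log (1 + m) := Real.log_le_log (by norm_num) (by linarith)
  have h3 := Real.log_two_gt_d9
  linarith

theorem min_le_rpow_mul_rpow {x y s : ℝ} (hx : 0 ≤ x) (hy : 0 ≤ y) (hs : 0 ≤ s) (hs1 : s < 1) :
    min x y ≤ x ^ s * y ^ (1 - s) := by
  have h0 : 0 ≤ min x y := le_min hx hy
  calc min x y = min x y ^ s * min x y ^ (1 - s) := by
        rw [← Real.rpow_add' h0 (by norm_num), add_sub_cancel, Real.rpow_one]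
    _ ≤ _ := by
        have hs' : 0 ≤ 1 - s := by linarith
        gcongr
        · exact min_le_left _ _
        · exact min_le_right _ _

theorem one_le_log_exp_one_mul {x : ℝ} (hx : 1 ≤ x) : 1 ≤ Real.log (Real.exp 1 * x) := by
  rw [Real.log_mul (Real.exp_pos 1).ne' (by positivity), Real.log_exp]
  linarith [Real.log_nonneg hx]

theorem exp_neg_log_exp_one_mul_le {x : ℝ} (hx : 0 < x) :
    Real.exp (-Real.log (Real.exp 1 * x)) ≤ x⁻¹ := by
  rw [Real.exp_neg, Real.exp_log (by positivity)]
  have : 1 ≤ Real.exp 1 := Real.one_le_exp zero_le_one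
  gcongr
  nlinarith

variable {n d : ℕ} {σ R B : ℝ}

theorem hardRate_lower {s : ℕ} (hdn : d ≤ n) (hσ : 0 < σ) (hB : 0 < B) (hs : 1 ≤ s)
    (hsd : s ≤ d) :
    ENNReal.ofReal (1 / 30 * hardRate n d s σ B) ≤ minimaxRisk n d 0 σ s B := by
  have hn : 0 < n := by omega
  have hs' : (0 : ℝ) < s := by exact_mod_cast hs
  have hx : 1 ≤ (d : ℝ) / s := by rw [le_div_iff₀ hs']; simpa using (by exact_mod_cast hsd)
  set l := Real.log (Real.exp 1 * (d / s)) with hl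
  have hl1 : 1 ≤ l := one_le_log_exp_one_mul hx
  have hm : 0 < d / s := Nat.div_pos hsd hs
  have hxm : (d : ℝ) / s ≤ 1 + (d / s : ℕ) := by
    rw [add_comm, ← Nat.floor_div_eq_div (K := ℝ)]
    exact (Nat.lt_floor_add_one _).le
  have hlog := log_le_log_one_add hm hx hxm
  set v := σ ^ 2 * B / n with hv
  have hv0 : 0 < v := by positivity
  have ha2 : √(2 / 5 * v * l) ^ 2 = 2 / 5 * v * l := Real.sq_sqrt (by positivity)
  have key := minimaxRisk_ge (k := s) (m := d / s) (a := √(2 / 5 * v * l)) (p := 0) (R := s)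
    hσ hB hn hdn (Real.sqrt_nonneg _) hm (Nat.mul_div_le d s) (by rw [ha2]; nlinarith)
    fun ι c => (mem_lpBall_zero_iff _).2 (by exact_mod_cast card_support_spikes_le ι _ c)
  refine le_trans (ENNReal.ofReal_le_ofReal ?_) key
  rw [ha2, hardRate, ← hl, ← hv]
  have : 0 ≤ v * s * l := by positivity
  linarith

theorem hardRate_upper {s : ℕ} (hdn : d ≤ n) (hσ : 0 < σ) (hB : 0 < B) (hs : 1 ≤ s)
    (hsd : s ≤ d) :
    minimaxRisk n d 0 σ s B ≤ ENNReal.ofReal (20 * hardRate n d s σ B) := by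
  have hn : 0 < n := by omega
  have hs' : (0 : ℝ) < s := by exact_mod_cast hs
  have hd' : (0 : ℝ) < d := by exact_mod_cast (by omega : 0 < d)
  have hx : 1 ≤ (d : ℝ) / s := by rw [le_div_iff₀ hs']; simpa using (by exact_mod_cast hsd)
  set l := Real.log (Real.exp 1 * (d / s)) with hl
  have hl1 : 1 ≤ l := one_le_log_exp_one_mul hx
  set v := σ ^ 2 * B / n with hv
  have hv0 : 0 < v := by positivity
  refine (minimaxRisk_le (C := s * (2 * v * l)) hn hσ hB hl1 fun θ hθ => ?_).trans
    (ENNReal.ofReal_le_ofReal ?_)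
  · rw [← Finset.sum_filter_of_ne (p := fun i => θ i ≠ 0)]
    · refine (Finset.sum_le_card_nsmul _ _ (2 * v * l) fun i _ => min_le_right _ _).trans ?_
      rw [nsmul_eq_mul]
      exact mul_le_mul_of_nonneg_right ((mem_lpBall_zero_iff θ).1 hθ) (by positivity)
    · intro i _ h h0
      refine h ?_
      rw [h0, zero_pow two_ne_zero]
      exact min_eq_left (by positivity)
  · have h1 : d * v * Real.exp (-l) ≤ v * s * l := by
      calc d * v * Real.exp (-l) ≤ d * v * ((d : ℝ) / s)⁻¹ := by
            gcongr
            exact exp_neg_log_exp_one_mul_le (by positivity)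
        _ = v * s * 1 := by field_simp
        _ ≤ _ := by gcongr
    rw [hardRate, ← hl, ← hv]
    linarith

/-- The consequences of `τ² ∈ [d^{-2/p}, 1 / log (e d)]`, for `t = τ²`: the logarithmic factor is at
least `1` and the normalized squared spike size `t log (e d t^{p/2})` is at most `1`. -/
theorem weakRate_regime {p t : ℝ} (hd : 1 ≤ d) (hp : 0 < p)
    (ht : t ∈ Set.Icc ((d : ℝ) ^ (-2 / p)) ((Real.log (Real.exp 1 * d))⁻¹)) :
    0 < t ∧ 1 ≤ d * t ^ (p / 2) ∧ t * Real.log (Real.exp 1 * (d * t ^ (p / 2))) ≤ 1 := by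
  have hd' : (1 : ℝ) ≤ d := by exact_mod_cast hd
  have hd0 : (0 : ℝ) < d := by linarith
  have hlog := one_le_log_exp_one_mul hd'
  have ht0 : 0 < t := (Real.rpow_pos_of_pos hd0 _).trans_le ht.1
  have ht1 : t ≤ 1 := ht.2.trans (inv_le_one_of_one_le₀ hlog)
  refine ⟨ht0, ?_, ?_⟩
  · have h1 : ((d : ℝ) ^ (-2 / p)) ^ (p / 2) ≤ t ^ (p / 2) :=
      Real.rpow_le_rpow (by positivity) ht.1 (by positivity)
    rw [← Real.rpow_mul hd0.le, show -2 / p * (p / 2) = -1 by field_simp, Real.rpow_neg_one] at h1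
    calc (1 : ℝ) = d * (d : ℝ)⁻¹ := (mul_inv_cancel₀ hd0.ne').symm
      _ ≤ _ := by gcongr
  · have h1 : t ^ (p / 2) ≤ 1 := Real.rpow_le_one ht0.le ht1 (by positivity)
    have h2 : Real.log (Real.exp 1 * (d * t ^ (p / 2))) ≤ Real.log (Real.exp 1 * d) := by
      apply Real.log_le_log (by positivity)
      have := mul_le_mul_of_nonneg_left h1 hd0.le
      have he := Real.exp_pos 1
      nlinarith
    calc t * Real.log (Real.exp 1 * (d * t ^ (p / 2)))
        ≤ t * Real.log (Real.exp 1 * d) := mul_le_mul_of_nonneg_left h2 ht0.le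
      _ ≤ (Real.log (Real.exp 1 * d))⁻¹ * Real.log (Real.exp 1 * d) :=
          mul_le_mul_of_nonneg_right ht.2 (by linarith)
      _ = 1 := inv_mul_cancel₀ (by linarith)

theorem tau_rpow {p : ℝ} (n : ℕ) (σ R B : ℝ) :
    tau n σ R B ^ p = (tau n σ R B ^ 2) ^ (p / 2) := by
  rw [← Real.rpow_natCast, ← Real.rpow_mul (show 0 ≤ tau n σ R B from Real.sqrt_nonneg _)]
  congr 1
  push_cast
  ring

theorem weakRate_lower {p : ℝ} (hd : 1 ≤ d) (hdn : d ≤ n) (hσ : 0 < σ) (hR : 0 < R) (hB : 0 < B)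
    (hp : 0 < p)
    (hτ : tau n σ R B ^ 2 ∈ Set.Icc ((d : ℝ) ^ (-2 / p)) ((Real.log (Real.exp 1 * d))⁻¹)) :
    ENNReal.ofReal (1 / 30 * weakRate n d p σ R B) ≤ minimaxRisk n d p σ R B := by
  have hn : 0 < n := by omega
  have hn' : (0 : ℝ) < n := by exact_mod_cast hn
  obtain ⟨ht0, hx, hq1⟩ := weakRate_regime hd hp hτ
  have htv : R ^ 2 * tau n σ R B ^ 2 = σ ^ 2 * B / n := by rw [tau_sq hB]; field_simp
  rw [weakRate, tau_rpow, mul_assoc (Real.exp 1)]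
  set t := tau n σ R B ^ 2
  set l := Real.log (Real.exp 1 * (d * t ^ (p / 2))) with hl
  have hl1 : 1 ≤ l := one_le_log_exp_one_mul hx
  set q := t * l with hq
  have hq0 : 0 < q := by positivity
  have htq : t ≤ q := by nlinarith
  -- The number of spikes: `k` spikes of size `R √q` fill up the ball.
  set K := q ^ (-(p / 2)) with hK
  have hK1 : 1 ≤ K := Real.one_le_rpow_of_pos_of_le_one_of_nonpos hq0 hq1 (by linarith)
  set k := ⌊K⌋₊ with hk
  have hk1 : 1 ≤ k := Nat.one_le_floor_iff _ |>.2 hK1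
  have hk0 : (0 : ℝ) < k := by exact_mod_cast hk1
  have hkK : (k : ℝ) ≤ K := Nat.floor_le (by linarith)
  have hKk : K ≤ 2 * k := by
    have h1 := (Nat.lt_floor_add_one K).le
    have h2 : (1 : ℝ) ≤ k := by exact_mod_cast hk1
    linarith
  have hkt : k * t ^ (p / 2) ≤ 1 := by
    calc k * t ^ (p / 2) ≤ K * q ^ (p / 2) := by gcongr
      _ = 1 := by rw [hK, ← Real.rpow_add hq0, neg_add_cancel, Real.rpow_zero]
  have hxk : d * t ^ (p / 2) ≤ d / k := by
    rw [le_div_iff₀ hk0]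
    have hd0 : (0 : ℝ) ≤ d := by positivity
    nlinarith
  have hkd : k ≤ d := by
    have h1 : 1 ≤ (d : ℝ) / k := hx.trans hxk
    rw [le_div_iff₀ hk0, one_mul] at h1
    exact_mod_cast h1
  have hm : 0 < d / k := Nat.div_pos hkd hk1
  have hxm : d * t ^ (p / 2) ≤ 1 + (d / k : ℕ) := by
    refine hxk.trans ?_
    rw [add_comm, ← Nat.floor_div_eq_div (K := ℝ)]
    exact (Nat.lt_floor_add_one _).le
  have hlog := log_le_log_one_add hm hx hxm
  have ha2 : √(2 / 5 * R ^ 2 * q) ^ 2 = 2 / 5 * R ^ 2 * q := Real.sq_sqrt (by positivity)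
  have haR : √(2 / 5 * R ^ 2 * q) ^ p ≤ R ^ p * q ^ (p / 2) := by
    calc √(2 / 5 * R ^ 2 * q) ^ p ≤ (R * √q) ^ p := by
          refine Real.rpow_le_rpow (Real.sqrt_nonneg _) ?_ hp.le
          refine Real.sqrt_le_iff.2 ⟨by positivity, ?_⟩
          rw [mul_pow, Real.sq_sqrt hq0.le]
          have : 0 ≤ R ^ 2 * q := by positivity
          linarith
      _ = _ := by
          rw [Real.mul_rpow hR.le (Real.sqrt_nonneg _), Real.sqrt_eq_rpow, ← Real.rpow_mul hq0.le]
          congr 2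
          ring
  have key := minimaxRisk_ge (k := k) (m := d / k) (a := √(2 / 5 * R ^ 2 * q)) (p := p) (R := R)
    hσ hB hn hdn (Real.sqrt_nonneg _) hm (Nat.mul_div_le d k) ?_ fun ι c => ?_
  · refine le_trans (ENNReal.ofReal_le_ofReal ?_) key
    rw [ha2, sub_eq_add_neg, Real.rpow_add hq0, Real.rpow_one, ← hK]
    have : 0 ≤ R ^ 2 * q := by positivity
    nlinarith
  · rw [ha2, ← htv, hq]
    have : 0 ≤ R ^ 2 * t := by positivity
    nlinarith
  · rw [mem_lpBall_iff hp]
    have h1 : ∑ i, |spikes ι (√(2 / 5 * R ^ 2 * q)) c i| ^ p ≤ R ^ p := by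
      calc _ ≤ k * √(2 / 5 * R ^ 2 * q) ^ p :=
            sum_abs_rpow_spikes_le ι (Real.sqrt_nonneg _) hp c
        _ ≤ K * (R ^ p * q ^ (p / 2)) := by gcongr
        _ = R ^ p := by
            rw [mul_left_comm, hK, ← Real.rpow_add hq0, neg_add_cancel, Real.rpow_zero, mul_one]
    calc _ ≤ (R ^ p) ^ (1 / p) :=
          Real.rpow_le_rpow (Finset.sum_nonneg fun i _ => by positivity) h1 (by positivity)
      _ = R := by rw [one_div, Real.rpow_rpow_inv hR.le hp.ne']

theorem weakRate_upper {p : ℝ} (hd : 1 ≤ d) (hdn : d ≤ n) (hσ : 0 < σ) (hR : 0 < R) (hB : 0 < B)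
    (hp : 0 < p) (hp1 : p ≤ 1)
    (hτ : tau n σ R B ^ 2 ∈ Set.Icc ((d : ℝ) ^ (-2 / p)) ((Real.log (Real.exp 1 * d))⁻¹)) :
    minimaxRisk n d p σ R B ≤ ENNReal.ofReal (20 * weakRate n d p σ R B) := by
  have hn : 0 < n := by omega
  have hn' : (0 : ℝ) < n := by exact_mod_cast hn
  have hd' : (0 : ℝ) < d := by exact_mod_cast hd
  obtain ⟨ht0, hx, -⟩ := weakRate_regime hd hp hτ
  have htv : σ ^ 2 * B / n = R ^ 2 * tau n σ R B ^ 2 := by rw [tau_sq hB]; field_simp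
  rw [weakRate, tau_rpow, mul_assoc (Real.exp 1)]
  set t := tau n σ R B ^ 2
  set l := Real.log (Real.exp 1 * (d * t ^ (p / 2))) with hl
  have hl1 : 1 ≤ l := one_le_log_exp_one_mul hx
  set q := t * l with hq
  have hq0 : 0 < q := by positivity
  have htq : t ≤ q := by nlinarith
  have hy0 : 0 < 2 * (σ ^ 2 * B / n) * l := by positivity
  have hy : (2 * (σ ^ 2 * B / n) * l) ^ (1 - p / 2) ≤ 2 * (R ^ (2 - p) * q ^ (1 - p / 2)) := by
    rw [htv, show 2 * (R ^ 2 * t) * l = 2 * (R ^ 2 * q) by rw [hq]; ring,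
      Real.mul_rpow zero_le_two (by positivity), Real.mul_rpow (by positivity) hq0.le,
      ← Real.rpow_natCast R 2, ← Real.rpow_mul hR.le,
      show ((2 : ℕ) : ℝ) * (1 - p / 2) = 2 - p by push_cast; ring]
    have h2 : (2 : ℝ) ^ (1 - p / 2) ≤ 2 :=
      (Real.rpow_le_rpow_of_exponent_le one_le_two (by linarith)).trans_eq (Real.rpow_one 2)
    gcongr
  refine (minimaxRisk_le (C := 2 * (R ^ 2 * q ^ (1 - p / 2))) hn hσ hB hl1 fun θ hθ => ?_).trans
    (ENNReal.ofReal_le_ofReal ?_)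
  · have hsum : ∑ i, |θ i| ^ p ≤ R ^ p := by
      have h0 : 0 ≤ ∑ i, |θ i| ^ p := Finset.sum_nonneg fun i _ => by positivity
      have := Real.rpow_le_rpow (by positivity) ((mem_lpBall_iff hp θ).1 hθ) hp.le
      rwa [one_div, Real.rpow_inv_rpow h0 hp.ne'] at this
    calc ∑ i, min (θ i ^ 2) (2 * (σ ^ 2 * B / n) * l)
        ≤ ∑ i, |θ i| ^ p * (2 * (σ ^ 2 * B / n) * l) ^ (1 - p / 2) := by
          refine Finset.sum_le_sum fun i _ => ?_
          refine (min_le_rpow_mul_rpow (s := p / 2) (sq_nonneg _) hy0.le (by positivity)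
            (by linarith)).trans_eq ?_
          rw [← sq_abs, ← Real.rpow_natCast |θ i| 2, ← Real.rpow_mul (abs_nonneg _),
            show ((2 : ℕ) : ℝ) * (p / 2) = p by push_cast; ring]
      _ ≤ R ^ p * (2 * (R ^ (2 - p) * q ^ (1 - p / 2))) := by
          rw [← Finset.sum_mul]
          gcongr
      _ = 2 * (R ^ 2 * q ^ (1 - p / 2)) := by
          have : R ^ p * R ^ (2 - p) = R ^ 2 := by
            rw [← Real.rpow_add hR, add_sub_cancel, Real.rpow_two]
          rw [← this]
          ring
  · have h1 : d * (σ ^ 2 * B / n) * Real.exp (-l) ≤ R ^ 2 * q ^ (1 - p / 2) := by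
      calc d * (σ ^ 2 * B / n) * Real.exp (-l) ≤ d * (σ ^ 2 * B / n) * (d * t ^ (p / 2))⁻¹ := by
            gcongr
            exact exp_neg_log_exp_one_mul_le (by positivity)
        _ = R ^ 2 * t ^ (1 - p / 2) := by
            rw [htv, Real.rpow_sub ht0, Real.rpow_one]
            field_simp
        _ ≤ _ := by
            gcongr
            linarith
    linarith

end Rates

end SparseRegression

end

theorem theorem1 :
    ∃ cl cu : ℝ, 0 < cl ∧ cl < cu ∧
      ∀ (n d : ℕ), 1 ≤ d → d ≤ n →
      ∀ (σ R B : ℝ), 0 < σ → 0 < R → 0 < B →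
        (∀ p : ℝ, 0 < p → p ≤ 1 →
          SparseRegression.tau n σ R B ^ 2 ∈
            Set.Icc ((d : ℝ) ^ (-2 / p)) ((Real.log (Real.exp 1 * d))⁻¹) →
          ENNReal.ofReal (cl * SparseRegression.weakRate n d p σ R B)
              ≤ SparseRegression.minimaxRisk n d p σ R B ∧
          SparseRegression.minimaxRisk n d p σ R B
              ≤ ENNReal.ofReal (cu * SparseRegression.weakRate n d p σ R B)) ∧
        (∀ s : ℕ, 1 ≤ s → s ≤ d → R = s →
          ENNReal.ofReal (cl * SparseRegression.hardRate n d s σ B)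
              ≤ SparseRegression.minimaxRisk n d 0 σ s B ∧
          SparseRegression.minimaxRisk n d 0 σ s B
              ≤ ENNReal.ofReal (cu * SparseRegression.hardRate n d s σ B)) :=
  ⟨1 / 30, 20, by norm_num, by norm_num, fun _ _ hd hdn _ _ _ hσ hR hB =>
    ⟨fun _ hp hp1 hτ => ⟨SparseRegression.weakRate_lower hd hdn hσ hR hB hp hτ,
      SparseRegression.weakRate_upper hd hdn hσ hR hB hp hp1 hτ⟩,
    fun _ hs hsd _ => ⟨SparseRegression.hardRate_lower hdn hσ hB hs hsd,
      SparseRegression.hardRate_upper hdn hσ hB hs hsd⟩⟩⟩
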